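/- Let $\xi_1,\xi_2\in\mathbb{R}$ and $\underline{\xi}=(1,\xi_1,\xi_2)$. For $\underline{q}=(q_1,q_2)\in\mathbb{R}^2$ and $j=1,2,3$, let $L_{\underline{\xi},j}(\underline{q})$ be the smallest $t\in\mathbb{R}$ for which the inequalities $$|x_0|\le e^{t},\qquad |x_0\xi_1-x_1|\le e^{t-q_1},\qquad |x_0\xi_2-x_2|\le e^{t-q_2}$$ admit at least $j$ linearly independent solutions $(x_0,x_1,x_2)\in\mathbb{Z}^3$, and set $\underline{L}_{\underline{\xi}}(\underline{q})=(L_{\underline{\xi},1}(\underline{q}),L_{\underline{\xi},2}(\underline{q}),L_{\underline{\xi},3}(\underline{q}))$. Let $\Phi\colon\mathbb{R}^3\to\mathbb{R}^3$ be the map which lists the coordinates of a point in non-decreasing order. A real number $\xi$ is called badly approximable if there is a constant $c>0$ such that $|x_0\xi-x_1|\ge c^{-1}|x_0|^{-1}$ for all $(x_0,x_1)\in\mathbb{Z}^2$ with $x_0\ne 0$. Write $\mathcal{O}_{\underline{\xi}}(1)$ for a function of $\underline{q}$ with values in $\mathbb{R}^3$ whose maximum norm is bounded above by a constant depending only on $\underline{\xi}$.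 Then, for $\underline{q}=(q_1,q_2)\in\mathbb{R}^2$: (i) If $q_1\le 0$ and $q_2\le 0$, then $\underline{L}_{\underline{\xi}}(\underline{q})=\Phi(0,q_1,q_2)+\mathcal{O}_{\underline{\xi}}(1)$. (ii) Suppose that $\xi_1$ is badly approximable. If $q_1\ge\max\{0,2q_2\}$, then $\underline{L}_{\underline{\xi}}(\underline{q})=(q_2,q_1/2,q_1/2)+\mathcal{O}_{\underline{\xi}}(1)$. (iii) Suppose that $\xi_2$ is badly approximable. If $q_2\ge\max\{0,2q_1\}$, then $\underline{L}_{\underline{\xi}}(\underline{q})=(q_1,q_2/2,q_2/2)+\mathcal{O}_{\underline{\xi}}(1)$. -/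

import Mathlib

namespace ParamGeom

/-- The integer points `x = (x₀, x₁, x₂)` of the dilated parallelepiped `e^t C_ξ(q₁, q₂)`
attached to `ξ = (1, ξ₁, ξ₂)`:
`|x₀| ≤ e^t`, `|x₀ ξ₁ - x₁| ≤ e^(t - q₁)`, `|x₀ ξ₂ - x₂| ≤ e^(t - q₂)`. -/
def latticePoints (ξ₁ ξ₂ q₁ q₂ t : ℝ) : Set (Fin 3 → ℤ) :=
  {x | |(x 0 : ℝ)| ≤ Real.exp t ∧
    |(x 0 : ℝ) * ξ₁ - (x 1 : ℝ)| ≤ Real.exp (t - q₁) ∧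
    |(x 0 : ℝ) * ξ₂ - (x 2 : ℝ)| ≤ Real.exp (t - q₂)}

/-- The set of all real `t` such that `e^t C_ξ(q₁, q₂)` contains at least `j` linearly
independent integer points. -/
def admissible (ξ₁ ξ₂ q₁ q₂ : ℝ) (j : ℕ) : Set ℝ :=
  {t | ∃ x : Fin j → Fin 3 → ℤ,
    LinearIndependent ℤ x ∧ ∀ i, x i ∈ latticePoints ξ₁ ξ₂ q₁ q₂ t}

/-- `L_{ξ,j}(q₁, q₂)`, the logarithm of the `j`-th successive minimum: the smallest real `t`
such that `e^t C_ξ(q₁, q₂)` contains at least `j` linearly independent integer points.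
For `j = 1, 2, 3` the infimum is attained, see `isLeast_logMin`. -/
noncomputable def logMin (ξ₁ ξ₂ q₁ q₂ : ℝ) (j : ℕ) : ℝ :=
  sInf (admissible ξ₁ ξ₂ q₁ q₂ j)

/-- The map `L_ξ = (L_{ξ,1}, L_{ξ,2}, L_{ξ,3})` from `ℝ²` to `ℝ³`. The norm on `Fin 3 → ℝ`
is the maximum norm. -/
noncomputable def logMinima (ξ₁ ξ₂ q₁ q₂ : ℝ) : Fin 3 → ℝ :=
  ![logMin ξ₁ ξ₂ q₁ q₂ 1, logMin ξ₁ ξ₂ q₁ q₂ 2, logMin ξ₁ ξ₂ q₁ q₂ 3]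

/-- The map `Φ` which lists the coordinates of a point of `ℝ³` in non-decreasing order. -/
noncomputable def sortCoords (p : Fin 3 → ℝ) : Fin 3 → ℝ :=
  p ∘ Tuple.sort p

/-- A real number `ξ` is badly approximable if there is `c > 0` such that
`|x₀ ξ - x₁| ≥ c⁻¹ |x₀|⁻¹` for all integers `x₀ ≠ 0` and `x₁`. -/
def BadlyApproximable (ξ : ℝ) : Prop :=
  ∃ c : ℝ, 0 < c ∧ ∀ x₀ x₁ : ℤ, x₀ ≠ 0 →
    c⁻¹ * |(x₀ : ℝ)|⁻¹ ≤ |(x₀ : ℝ) * ξ - (x₁ : ℝ)|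

theorem latticePoints_mono (ξ₁ ξ₂ q₁ q₂ : ℝ) {s t : ℝ} (h : s ≤ t) :
    latticePoints ξ₁ ξ₂ q₁ q₂ s ⊆ latticePoints ξ₁ ξ₂ q₁ q₂ t := by
  rintro x ⟨h0, h1, h2⟩
  exact ⟨h0.trans (Real.exp_le_exp.2 h), h1.trans (Real.exp_le_exp.2 (by linarith)),
    h2.trans (Real.exp_le_exp.2 (by linarith))⟩

theorem latticePoints_finite (ξ₁ ξ₂ q₁ q₂ t : ℝ) :
    (latticePoints ξ₁ ξ₂ q₁ q₂ t).Finite := by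
  obtain ⟨N, hN⟩ := exists_nat_ge (Real.exp t + (Real.exp t * |ξ₁| + Real.exp (t - q₁)) +
    (Real.exp t * |ξ₂| + Real.exp (t - q₂)))
  refine (Set.finite_Icc (fun _ : Fin 3 => -(N : ℤ)) (fun _ => (N : ℤ))).subset ?_
  rintro x ⟨h0, h1, h2⟩
  have key : ∀ i, |x i| ≤ (N : ℤ) := by
    have e0 := Real.exp_pos t
    have e1 := Real.exp_pos (t - q₁)
    have e2 := Real.exp_pos (t - q₂)
    have a1 : 0 ≤ Real.exp t * |ξ₁| := by positivity
    have a2 : 0 ≤ Real.exp t * |ξ₂| := by positivity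
    have aux : ∀ (ξ r : ℝ) (m : ℤ), |(x 0 : ℝ) * ξ - m| ≤ r → |(m : ℝ)| ≤ Real.exp t * |ξ| + r := by
      intro ξ r m hm
      have h := abs_sub_abs_le_abs_sub (m : ℝ) ((x 0 : ℝ) * ξ)
      rw [abs_sub_comm (m : ℝ), abs_mul] at h
      have := mul_le_mul_of_nonneg_right h0 (abs_nonneg ξ)
      linarith
    have b1 := aux _ _ _ h1
    have b2 := aux _ _ _ h2
    intro i
    have : |((x i : ℤ) : ℝ)| ≤ (N : ℝ) := by
      fin_cases i
      · exact le_trans h0 (by linarith)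
      · exact le_trans b1 (by linarith)
      · exact le_trans b2 (by linarith)
    exact_mod_cast this
  exact ⟨fun i => (abs_le.1 (key i)).1, fun i => (abs_le.1 (key i)).2⟩

theorem admissible_bddBelow (ξ₁ ξ₂ q₁ q₂ : ℝ) {j : ℕ} (hj : 1 ≤ j) :
    BddBelow (admissible ξ₁ ξ₂ q₁ q₂ j) := by
  refine ⟨min 0 (min q₁ q₂), ?_⟩
  rintro t ⟨x, hx, hxt⟩
  obtain ⟨h0, h1, h2⟩ := hxt ⟨0, hj⟩
  have hne := hx.ne_zero ⟨0, hj⟩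
  set y := x ⟨0, hj⟩
  have one : ∀ m : ℤ, m ≠ 0 → (1 : ℝ) ≤ |(m : ℝ)| := fun m hm => by
    exact_mod_cast Int.one_le_abs hm
  by_cases y0 : y 0 = 0
  · simp only [y0, Int.cast_zero, zero_mul, zero_sub, abs_neg] at h1 h2
    by_cases y1 : y 1 = 0
    · have y2 : y 2 ≠ 0 := fun y2 => hne (by ext i; fin_cases i <;> assumption)
      have := Real.one_le_exp_iff.1 ((one _ y2).trans h2)
      simp only [min_le_iff]; right; right; linarith
    · have := Real.one_le_exp_iff.1 ((one _ y1).trans h1)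
      simp only [min_le_iff]; right; left; linarith
  · have := Real.one_le_exp_iff.1 ((one _ y0).trans h0)
    simp only [min_le_iff]; left; linarith

theorem admissible_nonempty (ξ₁ ξ₂ q₁ q₂ : ℝ) {j : ℕ} (hj : j ≤ 3) :
    (admissible ξ₁ ξ₂ q₁ q₂ j).Nonempty := by
  have hlim : ∀ c r : ℝ, ∀ᶠ t in Filter.atTop, c ≤ Real.exp (t - r) := fun c r =>
    (Real.tendsto_exp_atTop.comp
      (Filter.tendsto_atTop_add_const_right _ (-r) Filter.tendsto_id)).eventually_ge_atTop c
  let e : Fin 3 → Fin 3 → ℤ := fun i => Pi.single i 1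
  have hli : LinearIndependent ℤ e := Pi.linearIndependent_single_one (Fin 3) ℤ
  have hev : ∀ᶠ t in Filter.atTop, ∀ i, e i ∈ latticePoints ξ₁ ξ₂ q₁ q₂ t := by
    refine Filter.eventually_all.2 fun i => ?_
    filter_upwards [hlim |(e i 0 : ℝ)| 0, hlim |(e i 0 : ℝ) * ξ₁ - (e i 1 : ℝ)| q₁,
      hlim |(e i 0 : ℝ) * ξ₂ - (e i 2 : ℝ)| q₂] with t h0 h1 h2
    exact ⟨by simpa using h0, h1, h2⟩
  obtain ⟨t, ht⟩ := hev.exists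
  exact ⟨t, e ∘ Fin.castLE hj, hli.comp _ (Fin.castLE_injective hj), fun i => ht _⟩

/-- For `j = 1, 2, 3` the real number `L_{ξ,j}(q₁, q₂)` is a genuine minimum. -/
theorem isLeast_logMin (ξ₁ ξ₂ q₁ q₂ : ℝ) {j : ℕ} (h1 : 1 ≤ j) (h3 : j ≤ 3) :
    IsLeast (admissible ξ₁ ξ₂ q₁ q₂ j) (logMin ξ₁ ξ₂ q₁ q₂ j) := by
  have hb := admissible_bddBelow ξ₁ ξ₂ q₁ q₂ h1
  have hn := admissible_nonempty ξ₁ ξ₂ q₁ q₂ h3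
  refine ⟨?_, fun t ht => csInf_le hb ht⟩
  set m := logMin ξ₁ ξ₂ q₁ q₂ j with hm
  let F : Set (Fin j → Fin 3 → ℤ) :=
    {x | LinearIndependent ℤ x ∧ ∀ i, x i ∈ latticePoints ξ₁ ξ₂ q₁ q₂ (m + 1)}
  have hF : F.Finite :=
    (Set.Finite.pi' fun _ : Fin j => latticePoints_finite ξ₁ ξ₂ q₁ q₂ (m + 1)).subset
      fun x hx => hx.2
  let T : Set ℝ := ⋃ x ∈ F, {t | ∀ i, x i ∈ latticePoints ξ₁ ξ₂ q₁ q₂ t}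
  have hT : IsClosed T := by
    refine hF.isClosed_biUnion fun x _ => ?_
    have hi : ∀ i, IsClosed {t | x i ∈ latticePoints ξ₁ ξ₂ q₁ q₂ t} := fun i =>
      (isClosed_le (f := fun _ : ℝ => |(x i 0 : ℝ)|) continuous_const
        (g := fun t => Real.exp t) (by fun_prop)).inter
      ((isClosed_le (f := fun _ : ℝ => |(x i 0 : ℝ) * ξ₁ - (x i 1 : ℝ)|) continuous_const
        (g := fun t => Real.exp (t - q₁)) (by fun_prop)).inter
      (isClosed_le (f := fun _ : ℝ => |(x i 0 : ℝ) * ξ₂ - (x i 2 : ℝ)|) continuous_const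
        (g := fun t => Real.exp (t - q₂)) (by fun_prop)))
    convert isClosed_iInter hi using 1
    ext t
    simp
  have hsub : T ⊆ admissible ξ₁ ξ₂ q₁ q₂ j := by
    intro t ht
    simp only [T, Set.mem_iUnion] at ht
    obtain ⟨x, hx, hxt⟩ := ht
    exact ⟨x, hx.1, hxt⟩
  refine hsub (hT.closure_subset (Metric.mem_closure_iff.2 fun ε hε => ?_))
  obtain ⟨t, ht, htm⟩ := exists_lt_of_csInf_lt hn
    (show sInf (admissible ξ₁ ξ₂ q₁ q₂ j) < m + min ε 1 by
      have : 0 < min ε 1 := lt_min hε one_pos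
      rw [← logMin, ← hm]; linarith)
  have hmt : m ≤ t := csInf_le hb ht
  obtain ⟨x, hx, hxt⟩ := ht
  refine ⟨t, ?_, ?_⟩
  · simp only [T, Set.mem_iUnion]
    exact ⟨x, ⟨hx, fun i => latticePoints_mono _ _ _ _
      (by linarith [min_le_right ε 1]) (hxt i)⟩, hxt⟩
  · rw [Real.dist_eq, abs_sub_comm, abs_of_nonneg (by linarith)]
    linarith [min_le_left ε 1]

end ParamGeom

namespace ParamGeom

/-! ### General facts about the successive minima -/

/-! Upper bounds come from exhibiting independent points, lower bounds from confining all points at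
small `t` to `{0}`, to `x₀ = x₁ = 0` or to `x₀ = 0` (`le_logMin`). For `q₁, q₂ ≤ 0` the points
`(0,0,1)`, `(0,1,0)`, `(1, round ξ₁, round ξ₂)` realise the minima exactly. For `ξ₁` badly
approximable, `|x₀| |x₀ξ₁ - x₁| ≤ e^(2t - q₁)` forces `x₀ = 0`, and then `x₁ = 0`, as soon as `t` is
below `q₁/2` by a constant, so only multiples of `(0,0,1)` remain. Conversely,
`exists_unimodular_approximations` at scale `e^(q₁/2)` gives two pairs `(x₀, x₁)` of determinant 1;
completed by `x₂ = round (x₀ξ₂)`, they form with `(0,0,1)` an independent triple near `t = q₁/2`.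
The case of `ξ₂` follows by symmetry. -/

theorem logMin_le {ξ₁ ξ₂ q₁ q₂ t : ℝ} {j : ℕ} (hj : 1 ≤ j) (x : Fin j → Fin 3 → ℤ)
    (hx : LinearIndependent ℤ x) (hxt : ∀ i, x i ∈ latticePoints ξ₁ ξ₂ q₁ q₂ t) :
    logMin ξ₁ ξ₂ q₁ q₂ j ≤ t :=
  csInf_le (admissible_bddBelow ξ₁ ξ₂ q₁ q₂ hj) ⟨x, hx, hxt⟩

theorem logMin_mono (ξ₁ ξ₂ q₁ q₂ : ℝ) {i j : ℕ} (hi : 1 ≤ i) (hij : i ≤ j) (hj : j ≤ 3) :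
    logMin ξ₁ ξ₂ q₁ q₂ i ≤ logMin ξ₁ ξ₂ q₁ q₂ j := by
  obtain ⟨x, hx, hxt⟩ := (isLeast_logMin ξ₁ ξ₂ q₁ q₂ (hi.trans hij) hj).1
  exact logMin_le hi (x ∘ Fin.castLE hij) (hx.comp _ (Fin.castLE_injective hij)) fun _ => hxt _

/-- If all lattice points of `e^t C_ξ(q₁, q₂)` with `t < a` lie in a submodule of rank `k < j`,
given as the image of `ℤ^k`, then `a ≤ L_{ξ,j}(q₁, q₂)`. -/
theorem le_logMin {ξ₁ ξ₂ q₁ q₂ a : ℝ} {j k : ℕ} (hj : j ≤ 3) (hk : k < j)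
    (g : (Fin k → ℤ) →ₗ[ℤ] (Fin 3 → ℤ))
    (h : ∀ t < a, ∀ x ∈ latticePoints ξ₁ ξ₂ q₁ q₂ t, ∃ y, g y = x) :
    a ≤ logMin ξ₁ ξ₂ q₁ q₂ j := by
  obtain ⟨x, hx, hxt⟩ := (isLeast_logMin ξ₁ ξ₂ q₁ q₂ (by omega) hj).1
  by_contra! hlt
  choose y hy using fun i => h _ hlt (x i) (hxt i)
  have hgy : g ∘ y = x := funext hy
  have hli : LinearIndependent ℤ y := LinearIndependent.of_comp g (hgy ▸ hx)
  have := hli.fintype_card_le_finrank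
  simp at this
  omega

theorem le_logMin_one {ξ₁ ξ₂ q₁ q₂ a : ℝ}
    (h : ∀ t < a, ∀ x ∈ latticePoints ξ₁ ξ₂ q₁ q₂ t, x = 0) :
    a ≤ logMin ξ₁ ξ₂ q₁ q₂ 1 :=
  le_logMin (k := 0) (by norm_num) (by norm_num) 0 fun t ht x hx => ⟨0, (h t ht x hx).symm⟩

theorem le_logMin_two {ξ₁ ξ₂ q₁ q₂ a : ℝ}
    (h : ∀ t < a, ∀ x ∈ latticePoints ξ₁ ξ₂ q₁ q₂ t, x 0 = 0 ∧ x 1 = 0) :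
    a ≤ logMin ξ₁ ξ₂ q₁ q₂ 2 := by
  refine le_logMin (k := 1) (by norm_num) (by norm_num)
    (Matrix.mulVecLin !![0; 0; 1]) fun t ht x hx => ⟨![x 2], ?_⟩
  obtain ⟨h0, h1⟩ := h t ht x hx
  ext i
  fin_cases i <;> simp [Matrix.mulVec, dotProduct, h0, h1]

theorem le_logMin_three {ξ₁ ξ₂ q₁ q₂ a : ℝ}
    (h : ∀ t < a, ∀ x ∈ latticePoints ξ₁ ξ₂ q₁ q₂ t, x 0 = 0) :
    a ≤ logMin ξ₁ ξ₂ q₁ q₂ 3 := by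
  refine le_logMin (k := 2) (by norm_num) (by norm_num)
    (Matrix.mulVecLin !![0, 0; 1, 0; 0, 1]) fun t ht x hx => ⟨![x 1, x 2], ?_⟩
  have h0 := h t ht x hx
  ext i
  fin_cases i <;> simp [Matrix.mulVec, dotProduct, h0]

theorem admissible_swap_subset (ξ₁ ξ₂ q₁ q₂ : ℝ) (j : ℕ) :
    admissible ξ₁ ξ₂ q₁ q₂ j ⊆ admissible ξ₂ ξ₁ q₂ q₁ j := by
  rintro t ⟨x, hx, hxt⟩
  let e := LinearEquiv.funCongrLeft ℤ ℤ (Equiv.swap (1 : Fin 3) 2)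
  refine ⟨e ∘ x, hx.map' e.toLinearMap e.ker, fun i => ?_⟩
  obtain ⟨h0, h1, h2⟩ := hxt i
  have e0 : e (x i) 0 = x i 0 := rfl
  have e1 : e (x i) 1 = x i 2 := rfl
  have e2 : e (x i) 2 = x i 1 := rfl
  simp only [latticePoints, Set.mem_ofPred_eq, Function.comp_apply, e0, e1, e2]
  exact ⟨h0, h2, h1⟩

/-- Exchanging the last two coordinates is an automorphism of `ℤ³`. This allows assuming `q₂ ≤ q₁`
in the non-positive case and deduces the case of `ξ₂` from that of `ξ₁`. -/
theorem logMinima_swap (ξ₁ ξ₂ q₁ q₂ : ℝ) :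
    logMinima ξ₁ ξ₂ q₁ q₂ = logMinima ξ₂ ξ₁ q₂ q₁ := by
  have h : ∀ j, logMin ξ₁ ξ₂ q₁ q₂ j = logMin ξ₂ ξ₁ q₂ q₁ j := fun j =>
    congrArg sInf ((admissible_swap_subset ξ₁ ξ₂ q₁ q₂ j).antisymm
      (admissible_swap_subset ξ₂ ξ₁ q₂ q₁ j))
  simp only [logMinima, h]

theorem norm_vec_three_sub_le {a₁ a₂ a₃ b₁ b₂ b₃ C : ℝ} (h₁ : |a₁ - b₁| ≤ C)
    (h₂ : |a₂ - b₂| ≤ C) (h₃ : |a₃ - b₃| ≤ C) :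
    ‖![a₁, a₂, a₃] - ![b₁, b₂, b₃]‖ ≤ C := by
  refine (pi_norm_le_iff_of_nonneg ((abs_nonneg _).trans h₁)).2 fun i => ?_
  fin_cases i <;> simpa

/-! ### Sizes of integers and the exponential -/

theorem eq_zero_of_abs_le_exp {m : ℤ} {s : ℝ} (hs : s < 0) (h : |(m : ℝ)| ≤ Real.exp s) :
    m = 0 := by
  by_contra hm
  have h1 : (1 : ℝ) ≤ |(m : ℝ)| := by exact_mod_cast Int.one_le_abs hm
  exact absurd (Real.one_le_exp_iff.1 (h1.trans h)) (not_le.2 hs)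

theorem abs_sub_round_le_exp (y : ℝ) {s : ℝ} (hs : 0 ≤ s) :
    |y - (round y : ℤ)| ≤ Real.exp s :=
  (abs_sub_round y).trans (by linarith [Real.one_le_exp hs])

theorem single_two_mem_latticePoints (ξ₁ ξ₂ q₁ q₂ : ℝ) :
    (![0, 0, 1] : Fin 3 → ℤ) ∈ latticePoints ξ₁ ξ₂ q₁ q₂ q₂ := by
  simp [latticePoints, Real.exp_nonneg]

theorem logMin_one_le (ξ₁ ξ₂ q₁ q₂ : ℝ) : logMin ξ₁ ξ₂ q₁ q₂ 1 ≤ q₂ :=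
  logMin_le le_rfl ![![0, 0, 1]]
    (by
      rw [Fintype.linearIndependent_iff]
      intro g hg i
      have h2 := congrFun hg 2
      fin_cases i
      simpa using h2)
    (fun i => by fin_cases i; exact single_two_mem_latticePoints ξ₁ ξ₂ q₁ q₂)

/-! ### Both parameters non-positive -/

theorem logMinima_eq_of_nonpos {ξ₁ ξ₂ q₁ q₂ : ℝ} (h₁ : q₁ ≤ 0) (h : q₂ ≤ q₁) :
    logMinima ξ₁ ξ₂ q₁ q₂ = ![q₂, q₁, 0] := by
  have z0 : ∀ t < (0 : ℝ), ∀ x ∈ latticePoints ξ₁ ξ₂ q₁ q₂ t, x 0 = 0 :=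
    fun t ht x hx => eq_zero_of_abs_le_exp ht hx.1
  have z1 : ∀ t < q₁, ∀ x ∈ latticePoints ξ₁ ξ₂ q₁ q₂ t, x 0 = 0 ∧ x 1 = 0 := by
    intro t ht x hx
    have h0 := z0 t (by linarith) x hx
    have hx1 := hx.2.1
    simp only [h0, Int.cast_zero, zero_mul, zero_sub, abs_neg] at hx1
    exact ⟨h0, eq_zero_of_abs_le_exp (by linarith) hx1⟩
  have z2 : ∀ t < q₂, ∀ x ∈ latticePoints ξ₁ ξ₂ q₁ q₂ t, x = 0 := by
    intro t ht x hx
    obtain ⟨h0, h1⟩ := z1 t (by linarith) x hx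
    have hx2 := hx.2.2
    simp only [h0, Int.cast_zero, zero_mul, zero_sub, abs_neg] at hx2
    have h2 := eq_zero_of_abs_le_exp (by linarith) hx2
    ext i
    fin_cases i <;> assumption
  have m2 := single_two_mem_latticePoints ξ₁ ξ₂ q₁ q₂
  have m1 : (![0, 1, 0] : Fin 3 → ℤ) ∈ latticePoints ξ₁ ξ₂ q₁ q₂ q₁ := by
    simp [latticePoints, Real.exp_nonneg]
  have m0 : (![1, round ξ₁, round ξ₂] : Fin 3 → ℤ) ∈ latticePoints ξ₁ ξ₂ q₁ q₂ 0 := by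
    refine ⟨by simp, ?_, ?_⟩
    · simpa using abs_sub_round_le_exp ξ₁ (s := 0 - q₁) (by linarith)
    · simpa using abs_sub_round_le_exp ξ₂ (s := 0 - q₂) (by linarith)
  have e1 : logMin ξ₁ ξ₂ q₁ q₂ 1 = q₂ :=
    (logMin_one_le ξ₁ ξ₂ q₁ q₂).antisymm (le_logMin_one z2)
  have e2 : logMin ξ₁ ξ₂ q₁ q₂ 2 = q₁ := by
    refine (logMin_le (by norm_num) ![![0, 0, 1], ![0, 1, 0]] ?_ fun i => ?_).antisymm
      (le_logMin_two z1)
    · rw [Fintype.linearIndependent_iff]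
      intro g hg i
      have hg1 := congrFun hg 1
      have hg2 := congrFun hg 2
      simp [Fin.sum_univ_two] at hg1 hg2
      fin_cases i <;> assumption
    · fin_cases i
      · exact latticePoints_mono _ _ _ _ h m2
      · exact m1
  have e3 : logMin ξ₁ ξ₂ q₁ q₂ 3 = 0 := by
    refine (logMin_le (by norm_num) ![![0, 0, 1], ![0, 1, 0], ![1, round ξ₁, round ξ₂]] ?_
      fun i => ?_).antisymm (le_logMin_three z0)
    · rw [Fintype.linearIndependent_iff]
      intro g hg i
      have hg0 := congrFun hg 0
      have hg1 := congrFun hg 1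
      have hg2 := congrFun hg 2
      simp [Fin.sum_univ_three] at hg0 hg1 hg2
      simp [hg0] at hg1 hg2
      fin_cases i <;> assumption
    · fin_cases i
      · exact latticePoints_mono _ _ _ _ (h.trans h₁) m2
      · exact latticePoints_mono _ _ _ _ h₁ m1
      · exact m0
  simp only [logMinima, e1, e2, e3]

theorem sortCoords_eq_of_monotone {p : Fin 3 → ℝ} (σ : Equiv.Perm (Fin 3)) {a b c : ℝ}
    (hσ : p ∘ σ = ![a, b, c]) (hab : a ≤ b) (hbc : b ≤ c) : sortCoords p = ![a, b, c] := by
  rw [sortCoords, ← hσ, eq_comm, Tuple.comp_sort_eq_comp_iff_monotone, hσ,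
    Fin.monotone_iff_le_succ]
  intro i
  fin_cases i
  · exact hab
  · exact hbc

theorem logMinima_eq_sortCoords {ξ₁ ξ₂ q₁ q₂ : ℝ} (h₁ : q₁ ≤ 0) (h₂ : q₂ ≤ 0) :
    logMinima ξ₁ ξ₂ q₁ q₂ = sortCoords ![0, q₁, q₂] := by
  rcases le_total q₂ q₁ with h | h
  · rw [logMinima_eq_of_nonpos h₁ h,
      sortCoords_eq_of_monotone (Equiv.swap 0 2) _ h h₁]
    ext i
    fin_cases i <;> rfl
  · rw [logMinima_swap, logMinima_eq_of_nonpos h₂ h,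
      sortCoords_eq_of_monotone (finRotate 3) _ h h₂]
    ext i
    fin_cases i <;> rfl

/-! ### Badly approximable numbers -/

/-- Two integer points forming a unimodular basis of `ℤ²`, both adapted to the scale `Q`. -/
theorem exists_unimodular_approximations {ξ c : ℝ} (hc : 0 < c)
    (h : ∀ x₀ x₁ : ℤ, x₀ ≠ 0 → c⁻¹ * |(x₀ : ℝ)|⁻¹ ≤ |(x₀ : ℝ) * ξ - (x₁ : ℝ)|)
    {Q : ℝ} (hQ : 1 ≤ Q) :
    ∃ k m u v : ℤ, k * v - m * u = 1 ∧ |(k : ℝ)| ≤ Q ∧ |(u : ℝ)| ≤ Q ∧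
      |(k : ℝ) * ξ - m| ≤ (1 + c) * Q⁻¹ ∧ |(u : ℝ) * ξ - v| ≤ (1 + c) * Q⁻¹ := by
  have hQ0 : 0 < Q := by linarith
  obtain ⟨r, hr, hrn⟩ := Real.exists_rat_abs_sub_le_and_den_le ξ (Nat.floor_pos.2 hQ)
  have hkpos : (0 : ℝ) < r.den := by exact_mod_cast r.den_pos
  have hkQ : (r.den : ℝ) ≤ Q := (Nat.cast_le.2 hrn).trans (Nat.floor_le hQ0.le)
  have hdk : |(r.den : ℝ) * ξ - r.num| ≤ Q⁻¹ := by
    have e : (r.den : ℝ) * ξ - r.num = r.den * (ξ - r) := by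
      rw [mul_sub, show (r.den : ℝ) * (r : ℝ) = r.num by exact_mod_cast r.den_mul_eq_num]
    rw [e, abs_mul, abs_of_pos hkpos]
    calc (r.den : ℝ) * |ξ - r| ≤ r.den * (1 / ((⌊Q⌋₊ + 1) * r.den)) := by gcongr
      _ = ((⌊Q⌋₊ : ℝ) + 1)⁻¹ := by field_simp
      _ ≤ Q⁻¹ := inv_anti₀ hQ0 (Nat.lt_floor_add_one Q).le
  -- The only use of bad approximability: the Dirichlet denominator cannot be much smaller than `Q`.
  have hk : (r.den : ℝ)⁻¹ ≤ c * Q⁻¹ := by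
    have h1 := (h r.den r.num (by exact_mod_cast r.den_ne_zero)).trans (by exact_mod_cast hdk)
    simp only [Int.cast_natCast, abs_of_pos hkpos] at h1
    calc (r.den : ℝ)⁻¹ = c * (c⁻¹ * (r.den : ℝ)⁻¹) := by field_simp
      _ ≤ c * Q⁻¹ := by gcongr
  have hcop : IsCoprime r.num (r.den : ℤ) := Int.isCoprime_iff_gcd_eq_one.2 r.reduced
  obtain ⟨a, b, hab⟩ := hcop
  have hd0 : (r.den : ℤ) ≠ 0 := by exact_mod_cast r.den_ne_zero
  set k : ℤ := (r.den : ℤ) with hkdef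
  set m : ℤ := r.num
  have hkr : (k : ℝ) = r.den := by simp [hkdef]
  -- The Bézout coefficient is reduced modulo `k`, so that the second point satisfies `0 ≤ u < k ≤
  -- Q`.
  have hu0 : 0 ≤ (-a) % k := Int.emod_nonneg _ hd0
  have huk : (-a) % k < k := Int.emod_lt_of_pos _ (by positivity)
  have hdiv := Int.emod_add_mul_ediv (-a) k
  set u : ℤ := (-a) % k
  set w : ℤ := (-a) / k
  have hdet : k * (b - m * w) - m * u = 1 := by linear_combination hab - m * hdiv
  have hu0' : (0 : ℝ) ≤ u := by exact_mod_cast hu0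
  have huk' : (u : ℝ) ≤ k := by exact_mod_cast huk.le
  rw [← hkr] at hkpos hkQ hdk hk
  refine ⟨k, m, u, b - m * w, hdet, by rwa [abs_of_pos hkpos],
    by rw [abs_of_nonneg hu0']; linarith, hdk.trans ?_, ?_⟩
  · have : 0 < c * Q⁻¹ := by positivity
    linarith
  · set v : ℤ := b - m * w
    have hdet' : (k : ℝ) * v - m * u = 1 := by exact_mod_cast hdet
    -- Determinant 1 bounds the second error by the first plus `1/k`, hence by `(1 + c)/Q`.
    have e : (u : ℝ) * ξ - v = u / k * (k * ξ - m) - (k : ℝ)⁻¹ := by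
      field_simp
      linear_combination -hdet'
    calc |(u : ℝ) * ξ - v| ≤ |u / k * (k * ξ - m)| + |(k : ℝ)⁻¹| := e ▸ abs_sub _ _
      _ = u / k * |k * ξ - m| + (k : ℝ)⁻¹ := by
        rw [abs_mul, abs_of_nonneg (by positivity : 0 ≤ (u : ℝ) / k),
          abs_of_pos (inv_pos.2 hkpos)]
      _ ≤ 1 * Q⁻¹ + c * Q⁻¹ := by
        gcongr
        exact (div_le_one hkpos).2 huk'
      _ = (1 + c) * Q⁻¹ := by ring

theorem linearIndependent_of_unimodular {k m u v : ℤ} (a b : ℤ) (h : k * v - m * u = 1) :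
    LinearIndependent ℤ ![![0, 0, 1], ![k, m, a], ![u, v, b]] := by
  rw [Fintype.linearIndependent_iff]
  intro g hg
  have hg0 := congrFun hg 0
  have hg1 := congrFun hg 1
  have hg2 := congrFun hg 2
  simp [Fin.sum_univ_three] at hg0 hg1 hg2
  -- Cramer's rule with determinant 1.
  have h1 : g 1 = 0 := by linear_combination v * hg0 - u * hg1 - g 1 * h
  have h2 : g 2 = 0 := by linear_combination k * hg1 - m * hg0 - g 2 * h
  simp [h1, h2] at hg2
  intro i
  fin_cases i <;> assumption

theorem exists_norm_logMinima_sub_le {ξ₁ : ℝ} (ξ₂ : ℝ) (hξ : BadlyApproximable ξ₁) :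
    ∃ C : ℝ, ∀ q₁ q₂ : ℝ, max 0 (2 * q₂) ≤ q₁ →
      ‖logMinima ξ₁ ξ₂ q₁ q₂ - ![q₂, q₁ / 2, q₁ / 2]‖ ≤ C := by
  obtain ⟨c, hc, h⟩ := hξ
  -- `e^C = 1 + c` absorbs the approximation constant in the upper bound, while `e^(-C) < c⁻¹`
  -- serves the lower bound.
  set C := Real.log (1 + c)
  have hC0 : 0 ≤ C := Real.log_nonneg (by linarith)
  have hexpC : Real.exp C = 1 + c := Real.exp_log (by linarith)
  refine ⟨C, fun q₁ q₂ hq => ?_⟩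
  obtain ⟨hq1, hq2⟩ := max_le_iff.1 hq
  have z : ∀ t < q₁ / 2 - C, ∀ x ∈ latticePoints ξ₁ ξ₂ q₁ q₂ t, x 0 = 0 ∧ x 1 = 0 := by
    rintro t ht x ⟨h0, h1, -⟩
    have hx0 : x 0 = 0 := by
      by_contra hx0
      have hpos : (0 : ℝ) < |(x 0 : ℝ)| := by positivity
      have hmul : c⁻¹ ≤ Real.exp (t - q₁) * Real.exp t :=
        calc c⁻¹ = c⁻¹ * |(x 0 : ℝ)|⁻¹ * |(x 0 : ℝ)| := by field_simp
          _ ≤ Real.exp (t - q₁) * Real.exp t := by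
            gcongr
            exact (h _ _ hx0).trans h1
      rw [← Real.exp_add] at hmul
      have hlt : Real.exp (t - q₁ + t) < (1 + c)⁻¹ := by
        rw [← hexpC, ← Real.exp_neg]
        exact Real.exp_lt_exp.2 (by linarith)
      have : (1 + c)⁻¹ ≤ c⁻¹ := inv_anti₀ hc (by linarith)
      linarith
    simp only [hx0, Int.cast_zero, zero_mul, zero_sub, abs_neg] at h1
    exact ⟨hx0, eq_zero_of_abs_le_exp (by linarith) h1⟩
  -- The loss of `C` keeps `t` in the range of `z`, since `q₂ ≤ q₁/2`.
  have l1 : q₂ - C ≤ logMin ξ₁ ξ₂ q₁ q₂ 1 := by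
    refine le_logMin_one fun t ht x hx => ?_
    obtain ⟨h0, h1⟩ := z t (by linarith) x hx
    have hx2 := hx.2.2
    simp only [h0, Int.cast_zero, zero_mul, zero_sub, abs_neg] at hx2
    have h2 := eq_zero_of_abs_le_exp (by linarith) hx2
    ext i
    fin_cases i <;> assumption
  have l2 : q₁ / 2 - C ≤ logMin ξ₁ ξ₂ q₁ q₂ 2 := le_logMin_two z
  have u1 := logMin_one_le ξ₁ ξ₂ q₁ q₂
  have mono := logMin_mono ξ₁ ξ₂ q₁ q₂ (i := 2) (j := 3) (by norm_num) (by norm_num) le_rfl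
  have u3 : logMin ξ₁ ξ₂ q₁ q₂ 3 ≤ q₁ / 2 + C := by
    obtain ⟨k, m, u, v, hdet, hk, hu, hkm, huv⟩ :=
      exists_unimodular_approximations hc h (Real.one_le_exp (by linarith : 0 ≤ q₁ / 2))
    have mem : ∀ y z : ℤ, |(y : ℝ)| ≤ Real.exp (q₁ / 2) →
        |(y : ℝ) * ξ₁ - z| ≤ (1 + c) * (Real.exp (q₁ / 2))⁻¹ →
        (![y, z, round (y * ξ₂)] : Fin 3 → ℤ) ∈ latticePoints ξ₁ ξ₂ q₁ q₂ (q₁ / 2 + C) := by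
      intro y z hy hyz
      refine ⟨?_, ?_, ?_⟩
      · simpa using hy.trans (Real.exp_le_exp.2 (by linarith))
      · rw [← hexpC, ← Real.exp_neg, ← Real.exp_add] at hyz
        simpa using hyz.trans (Real.exp_le_exp.2 (by linarith))
      -- Rounding suffices because `q₂ ≤ q₁/2` makes the third bound at least 1.
      · simpa using abs_sub_round_le_exp (y * ξ₂) (s := q₁ / 2 + C - q₂) (by linarith)
    refine logMin_le (by norm_num) _
      (linearIndependent_of_unimodular (round (k * ξ₂)) (round (u * ξ₂)) hdet) fun i => ?_
    fin_cases i
    · exact latticePoints_mono _ _ _ _ (by linarith) (single_two_mem_latticePoints ξ₁ ξ₂ q₁ q₂)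
    · exact mem k m hk hkm
    · exact mem u v hu huv
  refine norm_vec_three_sub_le ?_ ?_ ?_ <;> rw [abs_le] <;> constructor <;> linarith

end ParamGeom

theorem lemma2p3 (ξ₁ ξ₂ : ℝ) :
    (∃ C : ℝ, ∀ q₁ q₂ : ℝ, q₁ ≤ 0 → q₂ ≤ 0 →
      ‖ParamGeom.logMinima ξ₁ ξ₂ q₁ q₂ - ParamGeom.sortCoords ![0, q₁, q₂]‖ ≤ C) ∧
    (ParamGeom.BadlyApproximable ξ₁ →
      ∃ C : ℝ, ∀ q₁ q₂ : ℝ, max 0 (2 * q₂) ≤ q₁ →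
        ‖ParamGeom.logMinima ξ₁ ξ₂ q₁ q₂ - ![q₂, q₁ / 2, q₁ / 2]‖ ≤ C) ∧
    (ParamGeom.BadlyApproximable ξ₂ →
      ∃ C : ℝ, ∀ q₁ q₂ : ℝ, max 0 (2 * q₁) ≤ q₂ →
        ‖ParamGeom.logMinima ξ₁ ξ₂ q₁ q₂ - ![q₁, q₂ / 2, q₂ / 2]‖ ≤ C) := by
  refine ⟨⟨0, fun q₁ q₂ h₁ h₂ => ?_⟩, ParamGeom.exists_norm_logMinima_sub_le ξ₂, fun h => ?_⟩
  · simp [ParamGeom.logMinima_eq_sortCoords h₁ h₂]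
  · obtain ⟨C, hC⟩ := ParamGeom.exists_norm_logMinima_sub_le ξ₁ h
    refine ⟨C, fun q₁ q₂ hq => ?_⟩
    rw [ParamGeom.logMinima_swap]
    exact hC q₂ q₁ hq
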